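/- Let $N\ge 1$ parties $X^{(1)},\dots,X^{(N)}$ have finite-dimensional input spaces $X^{(i)}_I$ and output spaces $X^{(i)}_O$ of dimensions $d_{X^{(i)}_I},d_{X^{(i)}_O}\ge 1$, with fixed bases. Write $X_I$, $X_O$ for the tensor product of all inputs, respectively all outputs, and ${}_{Y}W=\frac{\mathbb 1_Y}{d_Y}\otimes\operatorname{tr}_YW$. Definitions. A *process* is a matrix $W\ge 0$ on $X_I\otimes X_O$ with $\operatorname{tr}[W^{T}(M_1\otimes\cdots\otimes M_N)]=1$ for all Choi matrices $M_i\ge 0$, $\operatorname{tr}_{X^{(i)}_O}M_i=\mathbb 1_{X^{(i)}_I}$, of channels of the parties; $\mathtt{Proc}$ is the set of processes. $\mathtt{Free}$ is the set of all $\rho_{X_I}\otimes\mathbb 1_{X_O}$ with $\rho_{X_I}$ a density matrix. The *signalling robustness* of $W\in\mathtt{Proc}$ is $$\mathcal R_s(W)=\min\Big\{s\ge 0:\ \tfrac{W+sT}{1+s}\in\mathtt{Free}\text{ for some }T\in\mathtt{Proc}\Big\}.$$ $\mathtt{Proc}_{1:N}$ is the set of processes with causal order $X^{(1)}\prec\cdots\prec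 X^{(N)}$, i.e. ${}_{Y_k}W={}_{Y_kX^{(k)}_O}W$ for $k=1,\dots,N$, where $Y_k$ consists of all input and output spaces of $X^{(k+1)},\dots,X^{(N)}$. A process has *definite last party* $X^{(p)}$ if ${}_{X^{(p)}_O}W=W$, and $\mathtt{Proc}^{\mathrm{conv}}_{\pi(N)}$ is the convex hull of all processes having some definite last party. A process is *Markovian* of order $X^{(1)}\prec\cdots\prec X^{(N)}$ if it is $\rho_{X^{(1)}_I}\otimes C_1\otimes\cdots\otimes C_{N-1}\otimes\mathbb 1_{X^{(N)}_O}$ with $\rho$ a density matrix and $C_i$ the Choi matrix of a channel from $X^{(i)}_O$ to $X^{(i+1)}_I$. If $d_{X^{(i)}_O}\le d_{X^{(i+1)}_I}$ for $i<N$, let $\Phi_i$ be the Choi matrix of the padded identity channel $\sigma\mapsto\begin{pmatrix}\sigma&0\\0&0\end{pmatrix}$ from $X^{(i)}_O$ to $X^{(i+1)}_I$ (the identity channel if the dimensions agree), and put $$W^{X^{(1)}\to\cdots\to X^{(N)}}=\frac{\mathbb 1_{X^{(1)}_I}}{d_{X^{(1)}_I}}\otimes\Phi_1\otimes\cdots\otimes\Phi_{N-1}\otimes\mathbb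 1_{X^{(N)}_O},\qquad S=\mathbb 1_{X^{(1)}_I}\otimes\Phi_1\otimes\cdots\otimes\Phi_{N-1}\otimes\frac{\mathbb 1_{X^{(N)}_O}}{d_{X^{(N)}_O}}.$$ Call $S'$ *dual feasible* if $S'\ge 0$ and $\mathbb 1-\operatorname{tr}_{X_O}S'\ge 0$. Theorem. The minimum defining $\mathcal R_s(W)$ is attained for every process $W$. Moreover: (a) If all the dimensions are equal to some $d\ge 1$, then $W^{X^{(1)}\to\cdots\to X^{(N)}}$ is Markovian, lies in $\mathtt{Proc}_{1:N}$, maximizes $\mathcal R_s$ on $\mathtt{Proc}_{1:N}$, and has $\mathcal R_s=d^{2(N-1)}-1$. The matrix $S$ satisfies $\operatorname{tr}_{X_O}S=\mathbb 1_{X_I}$, is dual feasible, and is an optimal dual witness, i.e. $\operatorname{tr}(W^{X^{(1)}\to\cdots\to X^{(N)}}S)-1=\mathcal R_s(W^{X^{(1)}\to\cdots\to X^{(N)}})$ and $\operatorname{tr}(W^{X^{(1)}\to\cdots\to X^{(N)}}S')-1\le\mathcal R_s(W^{X^{(1)}\to\cdots\to X^{(N)}})$ for all dual feasible $S'$. (b)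 For a permutation $\pi$ let $d_{\bar O}(\pi)=\prod_{i=1}^{N-1}d_{X^{(\pi(i))}_O}$. Let the parties be labelled so that $d_{\bar O}(\pi)$ is maximal at $\pi=\mathrm{id}$, and let $d_{X^{(i)}_O}\le d_{X^{(i+1)}_I}$ for $i=1,\dots,N-1$. Then $W^{X^{(1)}\to\cdots\to X^{(N)}}$ is Markovian, lies in $\mathtt{Proc}_{1:N}$, and maximizes $\mathcal R_s$ on $\mathtt{Proc}^{\mathrm{conv}}_{\pi(N)}$, with $$\mathcal R_s\big(W^{X^{(1)}\to\cdots\to X^{(N)}}\big)=\max_{\pi}\{d_{\bar O}(\pi)^2-1\};$$ it also lies in, and maximizes $\mathcal R_s$ on, the smaller convex hull of the processes that for some permutation $\pi$ satisfy in addition ${}_{X^{(\pi(N))}_IX^{(\pi(N))}_O}W={}_{X^{(\pi(N))}_IX^{(\pi(N))}_OX^{(\pi(N-1))}_O}W$ (besides ${}_{X^{(\pi(N))}_O}W=W$; for $N=1$ nothing is added). Again $S$ is dual feasible and an optimal dual witness in the sense of (a). -/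

import Mathlib

open scoped ComplexOrder Kronecker Matrix

namespace SignallingRobustness

/-! Parties are indexed by `Fin (n + 1)`, so `n + 1` is the number of parties; party `i` has an
input space of dimension `dI i` and an output space of dimension `dO i`. -/

/-- Basis labels of the tensor product of all input spaces (or of all output spaces). -/
abbrev Cfg {n : ℕ} (d : Fin (n + 1) → ℕ) : Type := ∀ i, Fin (d i)

/-- Matrices on the tensor product of all input and all output spaces, in the product basis. -/
abbrev Op {n : ℕ} (dI dO : Fin (n + 1) → ℕ) : Type :=
  Matrix (Cfg dI × Cfg dO) (Cfg dI × Cfg dO) ℂ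

/-- `M` is the Choi matrix of a completely positive trace preserving map with input basis `α`
and output basis `β`: it is positive semidefinite and its partial trace over the output is `1`. -/
def IsChannelChoi {α β : Type} [Fintype α] [DecidableEq α] [Fintype β]
    (M : Matrix (α × β) (α × β) ℂ) : Prop :=
  M.PosSemidef ∧ (Matrix.of fun a a' => ∑ b, M (a, b) (a', b)) = (1 : Matrix α α ℂ)

/-- `ρ` is a density matrix. -/
def IsState {α : Type} [Fintype α] (ρ : Matrix α α ℂ) : Prop :=
  ρ.PosSemidef ∧ ρ.trace = 1

section

variable {n : ℕ} {dI dO : Fin (n + 1) → ℕ}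

/-- The tensor product of local operators, one for each party. -/
def tensorLocal (M : ∀ i, Matrix (Fin (dI i) × Fin (dO i)) (Fin (dI i) × Fin (dO i)) ℂ) :
    Op dI dO :=
  Matrix.of fun x y => ∏ i, M i (x.1 i, x.2 i) (y.1 i, y.2 i)

/-- Proper process matrices: positive semidefinite and normalized on all local channels. -/
def IsProcess (W : Op dI dO) : Prop :=
  W.PosSemidef ∧
    ∀ M : ∀ i, Matrix (Fin (dI i) × Fin (dO i)) (Fin (dI i) × Fin (dO i)) ℂ,
      (∀ i, IsChannelChoi (M i)) → (Wᵀ * tensorLocal M).trace = 1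

/-- Free (non-signalling) processes: a state on all the inputs, tensored with the identity on
all the outputs. -/
def IsFree (W : Op dI dO) : Prop :=
  ∃ ρ : Matrix (Cfg dI) (Cfg dI) ℂ, IsState ρ ∧ W = ρ ⊗ₖ (1 : Matrix (Cfg dO) (Cfg dO) ℂ)

/-- The admissible noise levels: `s ≥ 0` for which some proper process `T` makes
`(W + s T) / (1 + s)` free. -/
def noiseLevels (W : Op dI dO) : Set ℝ :=
  {s | 0 ≤ s ∧ ∃ T : Op dI dO, IsProcess T ∧ IsFree ((1 + s)⁻¹ • (W + s • T))}

/-- The signalling robustness. -/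
noncomputable def robustness (W : Op dI dO) : ℝ := sInf (noiseLevels W)

/-- Replace the entries of `x` whose index lies in `A` by those of `a`. -/
def glue {d : Fin (n + 1) → ℕ} (A : Finset (Fin (n + 1))) (x : Cfg d)
    (a : ∀ i : A, Fin (d i)) : Cfg d :=
  fun i => if h : i ∈ A then a ⟨i, h⟩ else x i

/-- Trace out, and replace by the maximally mixed state, the inputs of the parties in `A` and
the outputs of the parties in `B`: the map `W ↦ (1 / d_X) ⊗ tr_X W`. -/
noncomputable def traceReplace (A B : Finset (Fin (n + 1))) (W : Op dI dO) : Op dI dO :=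
  Matrix.of fun x y =>
    if (∀ i ∈ A, x.1 i = y.1 i) ∧ (∀ i ∈ B, x.2 i = y.2 i) then
      ((∏ i ∈ A, (dI i : ℂ)) * ∏ i ∈ B, (dO i : ℂ))⁻¹ *
        ∑ a : (∀ i : A, Fin (dI i)), ∑ b : (∀ i : B, Fin (dO i)),
          W (glue A x.1 a, glue B x.2 b) (glue A y.1 a, glue B y.2 b)
    else 0

variable (dI dO)

/-- Causally ordered processes `0 ≺ 1 ≺ ⋯ ≺ n`: the comb conditions. After everything that
belongs to parties later than `k` is discarded, the output of `k` carries an identity. -/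
def orderedProcesses : Set (Op dI dO) :=
  {W | IsProcess W ∧ ∀ k : Fin (n + 1),
    traceReplace (Finset.Ioi k) (Finset.Ioi k) W = traceReplace (Finset.Ioi k) (Finset.Ici k) W}

/-- Processes with definite last party `p`: `p` cannot signal to the others, that is, the output
of `p` carries an identity. -/
def lastPartyProcesses (p : Fin (n + 1)) : Set (Op dI dO) :=
  {W | IsProcess W ∧ traceReplace ∅ {p} W = W}

/-- The smaller set of processes in which, for the order `π`, the last party is definite and, once
it is discarded, so is the last but one (if there is one). -/
def lastTwoProcesses (π : Equiv.Perm (Fin (n + 1))) : Set (Op dI dO) :=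
  {W | W ∈ lastPartyProcesses dI dO (π (Fin.last n)) ∧
    ∀ j : Fin n, j.succ = Fin.last n →
      traceReplace {π (Fin.last n)} {π (Fin.last n)} W =
        traceReplace {π (Fin.last n)} {π (Fin.last n), π j.castSucc} W}

/-- Convex hull of the processes with a definite last party. -/
def lastPartyHull : Set (Op dI dO) :=
  convexHull ℝ (⋃ p : Fin (n + 1), lastPartyProcesses dI dO p)

/-- Convex hull, over all orders, of the sets `lastTwoProcesses`. -/
def lastTwoHull : Set (Op dI dO) :=
  convexHull ℝ (⋃ π : Equiv.Perm (Fin (n + 1)), lastTwoProcesses dI dO π)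

variable {dI dO}

/-- `W` attains the maximum of the signalling robustness on `P`. -/
def MaximizesRobustnessOn (P : Set (Op dI dO)) (W : Op dI dO) : Prop :=
  W ∈ P ∧ ∀ V ∈ P, robustness V ≤ robustness W

/-- `ρ` on the first input, tensored with a matrix `C i` on the output of each party and the input
of the next one, tensored with `τ` on the last output. -/
def chainProduct (ρ : Matrix (Fin (dI 0)) (Fin (dI 0)) ℂ)
    (C : ∀ i : Fin n, Matrix (Fin (dO i.castSucc) × Fin (dI i.succ))
      (Fin (dO i.castSucc) × Fin (dI i.succ)) ℂ)
    (τ : Matrix (Fin (dO (Fin.last n))) (Fin (dO (Fin.last n))) ℂ) : Op dI dO :=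
  Matrix.of fun x y =>
    ρ (x.1 0) (y.1 0) *
      (∏ i : Fin n, C i (x.2 i.castSucc, x.1 i.succ) (y.2 i.castSucc, y.1 i.succ)) *
      τ (x.2 (Fin.last n)) (y.2 (Fin.last n))

/-- Markovian (memoryless) processes of order `0 ≺ ⋯ ≺ n`: an initial state, independent channels
from each party to the next, and the last output discarded. -/
def IsMarkovian (W : Op dI dO) : Prop :=
  ∃ (ρ : Matrix (Fin (dI 0)) (Fin (dI 0)) ℂ)
    (C : ∀ i : Fin n, Matrix (Fin (dO i.castSucc) × Fin (dI i.succ))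
      (Fin (dO i.castSucc) × Fin (dI i.succ)) ℂ),
    IsState ρ ∧ (∀ i, IsChannelChoi (C i)) ∧ W = chainProduct ρ C 1

/-- The Choi matrix of the padded identity channel `ρ ↦ diag(ρ, 0)` from dimension `a` to
dimension `b ≥ a`; for `a = b` it is `Φ⁺ = ∑ |ii⟩⟨jj|`, the one of the identity channel. -/
def paddedId (a b : ℕ) : Matrix (Fin a × Fin b) (Fin a × Fin b) ℂ :=
  Matrix.of fun x y => if (x.1 : ℕ) = x.2 ∧ (y.1 : ℕ) = y.2 then 1 else 0

variable (dI dO)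

/-- The chain of (padded) identity channels, with maximally mixed first input. -/
noncomputable def idChain : Op dI dO :=
  chainProduct ((dI 0 : ℂ)⁻¹ • 1) (fun i => paddedId (dO i.castSucc) (dI i.succ)) 1

/-- The explicit dual witness for `idChain`. -/
noncomputable def chainWitness : Op dI dO :=
  chainProduct 1 (fun i => paddedId (dO i.castSucc) (dI i.succ)) ((dO (Fin.last n) : ℂ)⁻¹ • 1)

variable {dI dO}

/-- Partial trace over all the outputs. -/
def traceOutputs (S : Op dI dO) : Matrix (Cfg dI) (Cfg dI) ℂ :=
  Matrix.of fun a a' => ∑ o, S (a, o) (a', o)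

/-- Feasible points of the semidefinite program dual to the signalling robustness, which
maximizes `tr (W S) - 1` over `S ≥ 0` with `1 - tr_O S ≥ 0`. -/
def IsDualFeasible (S : Op dI dO) : Prop :=
  S.PosSemidef ∧ (1 - traceOutputs S).PosSemidef

/-- `S` is an optimal point of the dual program of `W`, and its value is the robustness of `W`. -/
def IsOptimalWitness (W S : Op dI dO) : Prop :=
  IsDualFeasible S ∧ (W * S).trace - 1 = (robustness W : ℂ) ∧
    ∀ S' : Op dI dO, IsDualFeasible S' → (W * S').trace - 1 ≤ (robustness W : ℂ)

/-- The product of the output dimensions of all the parties except the last one in the order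
`π`. -/
def dimBar (dO : Fin (n + 1) → ℕ) (π : Equiv.Perm (Fin (n + 1))) : ℕ :=
  ∏ i : Fin n, dO (π i.castSucc)

/-- The maximum of `dimBar ^ 2 - 1` over all the orders of the parties. -/
noncomputable def maxBound (dO : Fin (n + 1) → ℕ) : ℝ :=
  Finset.univ.sup' ⟨1, Finset.mem_univ _⟩
    fun π : Equiv.Perm (Fin (n + 1)) => (dimBar dO π : ℝ) ^ 2 - 1

end

end SignallingRobustness

open SignallingRobustness

/-! The robustness is a semidefinite program: `1 + s` is the trace of some `σ` with `σ ⊗ 1 ≥ W`, and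
conversely the normalized difference `σ ⊗ 1 - W` is automatically a process, because `σ ⊗ 1` takes
the value `tr σ` on every product of local channels (`mem_noiseLevels_iff`). Compactness gives
attainment, and pairing with `S` gives weak duality.

Upper bound: let the output of `p` carry an identity and let `K` be the product of the other output
dimensions. The pinching inequality on those outputs gives `W ≤ K • pinch W`, and `pinch W ≤ (tr_O W
/ d_p) ⊗ 1`. So `W` is dominated by some `σ ⊗ 1` with `tr σ = K * tr W / d_p = K ^ 2`. Being
dominated within a given trace is a convex condition, so the bound extends to the hull
(`robustness_le_of_mem_lastPartyHull`).

Lower bound: the chain and its witness are multiples of the same `Pᴴ * P`, where `P = pathEnds`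
satisfies `P * Pᴴ = dimBar dO 1 • 1`. Hence `tr (W S) = dimBar dO 1 ^ 2`, which meets the upper
bound.

That the chain is a process is an induction on the parties; its comb conditions follow by
relabelling a traced-out input. -/

namespace SignallingRobustness

/-! ### Positive semidefinite matrices -/

section PosSemidef

variable {α : Type*} [Fintype α]

open scoped MatrixOrder Matrix.Norms.L2Operator in
theorem exists_eq_conjTranspose_mul_self {A : Matrix α α ℂ} (hA : A.PosSemidef) :
    ∃ B : Matrix α α ℂ, A = Bᴴ * B := by
  classical
  exact CStarAlgebra.nonneg_iff_eq_star_mul_self.mp (Matrix.nonneg_iff_posSemidef.mpr hA)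

theorem trace_mul_nonneg {A B : Matrix α α ℂ} (hA : A.PosSemidef) (hB : B.PosSemidef) :
    0 ≤ (A * B).trace := by
  obtain ⟨C, rfl⟩ := exists_eq_conjTranspose_mul_self hA
  rw [Matrix.mul_assoc, Matrix.trace_mul_comm]
  exact (hB.mul_mul_conjTranspose_same C).trace_nonneg

/-- With `A = Bᴴ * B`, entries are inner products of columns of `B`, and AM-GM bounds them by
diagonal entries. This makes the trace-bounded part of the primal program bounded, as compactness
requires. -/
theorem norm_apply_le_re_trace {A : Matrix α α ℂ} (hA : A.PosSemidef) (i j : α) :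
    ‖A i j‖ ≤ A.trace.re := by
  obtain ⟨B, rfl⟩ := exists_eq_conjTranspose_mul_self hA
  have hdiag : ∀ i, ((Bᴴ * B) i i).re = ∑ k, ‖B k i‖ ^ 2 := fun i => by
    simp only [Matrix.mul_apply, Matrix.conjTranspose_apply, Complex.re_sum]
    refine Finset.sum_congr rfl fun k _ => ?_
    rw [Complex.star_def, ← Complex.normSq_eq_conj_mul_self, Complex.ofReal_re,
      Complex.normSq_eq_norm_sq]
  have hle : ∀ i, ∑ k, ‖B k i‖ ^ 2 ≤ (Bᴴ * B).trace.re := fun i => by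
    rw [Matrix.trace, Complex.re_sum]
    simp only [Matrix.diag_apply, hdiag]
    exact Finset.single_le_sum (f := fun i => ∑ k, ‖B k i‖ ^ 2)
      (fun i _ => Finset.sum_nonneg fun k _ => sq_nonneg _) (Finset.mem_univ i)
  calc ‖(Bᴴ * B) i j‖ ≤ ∑ k, ‖B k i‖ * ‖B k j‖ := by
        rw [Matrix.mul_apply]
        refine (norm_sum_le _ _).trans (Finset.sum_le_sum fun k _ => ?_)
        simp
    _ ≤ ∑ k, (‖B k i‖ ^ 2 + ‖B k j‖ ^ 2) / 2 :=
        Finset.sum_le_sum fun k _ => by nlinarith [sq_nonneg (‖B k i‖ - ‖B k j‖)]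
    _ = (∑ k, ‖B k i‖ ^ 2 + ∑ k, ‖B k j‖ ^ 2) / 2 := by
        rw [← Finset.sum_add_distrib, Finset.sum_div]
    _ ≤ (Bᴴ * B).trace.re := by linarith [hle i, hle j]

theorem isClosed_posSemidef : IsClosed {A : Matrix α α ℂ | A.PosSemidef} := by
  simp only [Matrix.posSemidef_iff_dotProduct_mulVec, Set.ofPred_and, Set.ofPred_forall]
  refine IsClosed.inter ?_ (isClosed_iInter fun x => ?_)
  · exact isClosed_eq (by fun_prop) continuous_id
  · exact isClosed_le continuous_const (by fun_prop)

open scoped MatrixOrder Matrix.Norms.L2Operator in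
theorem exists_smul_one_sub_posSemidef [DecidableEq α] {A : Matrix α α ℂ} (hA : A.PosSemidef) :
    ∃ r : ℝ, (r • (1 : Matrix α α ℂ) - A).PosSemidef := by
  refine ⟨‖A‖, Matrix.le_iff.mp ?_⟩
  rw [← Algebra.algebraMap_eq_smul_one]
  exact hA.isHermitian.isSelfAdjoint.le_algebraMap_norm_self

omit [Fintype α] in
theorem posSemidef_real_smul {A : Matrix α α ℂ} (hA : A.PosSemidef) {r : ℝ} (hr : 0 ≤ r) :
    (r • A).PosSemidef := hA.smul hr

end PosSemidef

/-! ### Processes -/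

variable {n : ℕ} {dI dO : Fin (n + 1) → ℕ}

theorem nonempty_cfg {d : Fin (n + 1) → ℕ} (hd : ∀ i, 0 < d i) : Nonempty (Cfg d) :=
  ⟨fun i => ⟨0, hd i⟩⟩

theorem card_cfg (d : Fin (n + 1) → ℕ) : Fintype.card (Cfg d) = ∏ i, d i := by
  simp [Cfg]

theorem trace_kronecker_one (σ : Matrix (Cfg dI) (Cfg dI) ℂ) :
    (σ ⊗ₖ (1 : Matrix (Cfg dO) (Cfg dO) ℂ)).trace = σ.trace * ∏ i, (dO i : ℂ) := by
  rw [Matrix.trace_kronecker, Matrix.trace_one, card_cfg]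
  push_cast
  rfl

theorem trace_transpose_mul {α : Type*} [Fintype α] (A B : Matrix α α ℂ) :
    (Aᵀ * B).trace = ∑ x, ∑ y, A x y * B x y := by
  simp only [Matrix.trace, Matrix.diag_apply, Matrix.mul_apply, Matrix.transpose_apply]
  rw [Finset.sum_comm]

/-- The identity on the outputs traces out the output of each `M i`, leaving identities on the
inputs. This is why the noise `T` needs no normalization constraint of its own. -/
theorem trace_transpose_kronecker_one_mul_tensorLocal (σ : Matrix (Cfg dI) (Cfg dI) ℂ)
    {M : ∀ i, Matrix (Fin (dI i) × Fin (dO i)) (Fin (dI i) × Fin (dO i)) ℂ}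
    (hM : ∀ i, IsChannelChoi (M i)) :
    ((σ ⊗ₖ (1 : Matrix (Cfg dO) (Cfg dO) ℂ))ᵀ * tensorLocal M).trace = σ.trace := by
  have key : ∀ a a' : Cfg dI, ∑ o : Cfg dO, ∏ i, M i (a i, o i) (a' i, o i) =
      if a = a' then 1 else 0 := fun a a' => by
    have hM' : ∀ i, ∑ b, M i (a i, b) (a' i, b) = if a i = a' i then 1 else 0 := fun i => by
      have := congrFun (congrFun (hM i).2 (a i)) (a' i)
      simpa [Matrix.one_apply] using this
    have h := Finset.prod_univ_sum (fun i => (Finset.univ : Finset (Fin (dO i))))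
      fun i b => M i (a i, b) (a' i, b)
    rw [Fintype.piFinset_univ] at h
    rw [← h, Finset.prod_congr rfl fun i _ => hM' i, Finset.prod_ite_zero]
    simp [funext_iff]
  rw [trace_transpose_mul]
  simp only [Fintype.sum_prod_type, Matrix.kroneckerMap_apply, tensorLocal, Matrix.of_apply,
    Matrix.one_apply, mul_ite, mul_one, mul_zero, ite_mul, zero_mul, Finset.sum_ite_eq,
    Finset.mem_univ, if_true]
  calc _ = ∑ a, ∑ a', σ a a' * ∑ o : Cfg dO, ∏ i, M i (a i, o i) (a' i, o i) := by
        refine Finset.sum_congr rfl fun a _ => ?_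
        rw [Finset.sum_comm]
        simp only [Finset.mul_sum]
    _ = σ.trace := by simp [key, Matrix.trace]

theorem isChannelChoi_maximallyMixing {a b : ℕ} (hb : 0 < b) :
    IsChannelChoi ((b : ℂ)⁻¹ • (1 : Matrix (Fin a × Fin b) (Fin a × Fin b) ℂ)) := by
  refine ⟨Matrix.PosSemidef.one.smul (by positivity), ?_⟩
  ext x y
  have hb' : (b : ℂ) ≠ 0 := by exact_mod_cast hb.ne'
  by_cases h : x = y <;> simp [Matrix.one_apply, h, hb']

/-- Test `W` on the completely depolarizing channels, whose product is a multiple of the identity.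
-/
theorem IsProcess.trace_eq (hdO : ∀ i, 0 < dO i) {W : Op dI dO} (hW : IsProcess W) :
    W.trace = ∏ i, (dO i : ℂ) := by
  have h := hW.2 _ fun i => isChannelChoi_maximallyMixing (a := dI i) (hdO i)
  have ht : tensorLocal (fun i => (dO i : ℂ)⁻¹ •
      (1 : Matrix (Fin (dI i) × Fin (dO i)) (Fin (dI i) × Fin (dO i)) ℂ)) =
      (∏ i, (dO i : ℂ))⁻¹ • (1 : Op dI dO) := by
    ext x y
    have : x = y ↔ ∀ i, x.1 i = y.1 i ∧ x.2 i = y.2 i := by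
      rw [Prod.ext_iff, funext_iff, funext_iff, forall_and]
    simp only [tensorLocal, Matrix.of_apply, Matrix.smul_apply, Matrix.one_apply, smul_eq_mul,
      Prod.mk.injEq, Finset.prod_mul_distrib, Finset.prod_inv_distrib, Finset.prod_ite_zero,
      Finset.prod_const_one, Finset.mem_univ, true_imp_iff, this]
  have h0 : (∏ i, (dO i : ℂ)) ≠ 0 :=
    Finset.prod_ne_zero_iff.mpr fun i _ => by exact_mod_cast (hdO i).ne'
  rw [ht, Matrix.mul_smul, Matrix.mul_one, Matrix.trace_smul, Matrix.trace_transpose,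
    smul_eq_mul] at h
  field_simp at h
  exact h

theorem IsProcess.convex : Convex ℝ {W : Op dI dO | IsProcess W} := by
  rintro V hV W hW a b ha hb hab
  refine ⟨(posSemidef_real_smul hV.1 ha).add (posSemidef_real_smul hW.1 hb), fun M hM => ?_⟩
  rw [Matrix.transpose_add, Matrix.transpose_smul, Matrix.transpose_smul, Matrix.add_mul,
    Matrix.smul_mul, Matrix.smul_mul, Matrix.trace_add, Matrix.trace_smul, Matrix.trace_smul,
    hV.2 M hM, hW.2 M hM, ← add_smul, hab, one_smul]

theorem posSemidef_of_kronecker_one (hdO : ∀ i, 0 < dO i) {σ : Matrix (Cfg dI) (Cfg dI) ℂ}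
    (h : (σ ⊗ₖ (1 : Matrix (Cfg dO) (Cfg dO) ℂ)).PosSemidef) : σ.PosSemidef := by
  obtain ⟨o⟩ := nonempty_cfg hdO
  convert h.submatrix fun a => (a, o)
  ext a a'
  simp

/-! ### The robustness as a semidefinite program -/

/-- `σ ⊗ 1` dominates `W`. -/
def Dominates (σ : Matrix (Cfg dI) (Cfg dI) ℂ) (W : Op dI dO) : Prop :=
  (σ ⊗ₖ (1 : Matrix (Cfg dO) (Cfg dO) ℂ) - W).PosSemidef

theorem Dominates.posSemidef (hdO : ∀ i, 0 < dO i) {σ : Matrix (Cfg dI) (Cfg dI) ℂ}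
    {W : Op dI dO} (h : Dominates σ W) (hW : W.PosSemidef) : σ.PosSemidef :=
  posSemidef_of_kronecker_one hdO (by simpa using Matrix.PosSemidef.add h hW)

/-- The correspondence is `σ = (1 + s) • ρ` and `s • T = σ ⊗ 1 - W`. Positivity of the difference
already forces `s ≥ 0`. -/
theorem mem_noiseLevels_iff (hdO : ∀ i, 0 < dO i) {W : Op dI dO} (hW : IsProcess W) {s : ℝ} :
    s ∈ noiseLevels W ↔ ∃ σ, Dominates σ W ∧ σ.trace = ((1 + s : ℝ) : ℂ) := by
  constructor
  · rintro ⟨hs, T, hT, ρ, hρ, h⟩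
    have hs' : (1 + s) ≠ 0 := by positivity
    refine ⟨(1 + s) • ρ, ?_, ?_⟩
    · have h' : W + s • T = (1 + s) • (ρ ⊗ₖ (1 : Matrix (Cfg dO) (Cfg dO) ℂ)) := by
        rw [← h, smul_smul, mul_inv_cancel₀ hs', one_smul]
      rw [Dominates, Matrix.smul_kronecker, ← h', add_sub_cancel_left]
      exact posSemidef_real_smul hT.1 hs
    · rw [Matrix.trace_smul, hρ.2, Complex.real_smul, mul_one]
  · rintro ⟨σ, hσ, htr⟩
    have hσ0 : σ.PosSemidef := hσ.posSemidef hdO hW.1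
    have hD : 0 < ∏ i, (dO i : ℝ) := Finset.prod_pos fun i _ => by exact_mod_cast hdO i
    have htrace : (σ ⊗ₖ (1 : Matrix (Cfg dO) (Cfg dO) ℂ) - W).trace =
        ((s * ∏ i, (dO i : ℝ) : ℝ) : ℂ) := by
      rw [Matrix.trace_sub, trace_kronecker_one, hW.trace_eq hdO, htr]
      push_cast
      ring
    have hs : 0 ≤ s := by
      have := hσ.trace_nonneg
      rw [htrace, Complex.zero_le_real] at this
      exact nonneg_of_mul_nonneg_left this hD
    refine ⟨hs, ?_⟩
    have hs1 : (0 : ℝ) < 1 + s := by positivity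
    have hstate : IsState ((1 + s)⁻¹ • σ) := by
      refine ⟨posSemidef_real_smul hσ0 (by positivity), ?_⟩
      rw [Matrix.trace_smul, htr, Complex.real_smul, ← Complex.ofReal_mul,
        inv_mul_cancel₀ hs1.ne', Complex.ofReal_one]
    -- At `s = 0` one cannot divide by `s`; the difference is then positive with trace zero, hence
    -- zero, and `W` itself serves as `T`.
    rcases hs.eq_or_lt with rfl | hs0
    · have hWσ : W = σ ⊗ₖ (1 : Matrix (Cfg dO) (Cfg dO) ℂ) := by
        rw [zero_mul, Complex.ofReal_zero, hσ.trace_eq_zero_iff, sub_eq_zero] at htrace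
        exact htrace.symm
      refine ⟨W, hW, _, hstate, ?_⟩
      rw [zero_smul, add_zero, add_zero, Matrix.smul_kronecker, ← hWσ]
    · refine ⟨s⁻¹ • (σ ⊗ₖ (1 : Matrix (Cfg dO) (Cfg dO) ℂ) - W),
        ⟨posSemidef_real_smul hσ (by positivity), fun M hM => ?_⟩, _, hstate, ?_⟩
      · rw [Matrix.transpose_smul, Matrix.smul_mul, Matrix.trace_smul, Matrix.transpose_sub,
          Matrix.sub_mul, Matrix.trace_sub, hW.2 M hM,
          trace_transpose_kronecker_one_mul_tensorLocal σ hM, htr, Complex.real_smul]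
        have : (s : ℂ) ≠ 0 := by exact_mod_cast hs0.ne'
        push_cast
        field_simp
        ring
      · rw [smul_smul, mul_inv_cancel₀ hs0.ne', one_smul, add_sub_cancel, Matrix.smul_kronecker]

theorem exists_dominates {W : Op dI dO} (hW : W.PosSemidef) : ∃ σ, Dominates σ W := by
  obtain ⟨r, hr⟩ := exists_smul_one_sub_posSemidef hW
  refine ⟨r • 1, ?_⟩
  rwa [Dominates, Matrix.smul_kronecker, Matrix.one_kronecker_one]

theorem isClosed_dominates (W : Op dI dO) : IsClosed {σ | Dominates σ W} := by
  refine isClosed_posSemidef.preimage (Continuous.sub ?_ continuous_const)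
  refine continuous_matrix fun x y => ?_
  simp only [Matrix.kroneckerMap_apply]
  fun_prop

theorem isLeast_robustness (hdO : ∀ i, 0 < dO i) {W : Op dI dO} (hW : IsProcess W) :
    IsLeast (noiseLevels W) (robustness W) := by
  obtain ⟨σ₀, hσ₀⟩ := exists_dominates hW.1
  -- Cutting at the trace of one feasible `σ₀` makes the feasible set compact without losing any
  -- minimizer.
  let K : Set (Matrix (Cfg dI) (Cfg dI) ℂ) := {σ | Dominates σ W ∧ σ.trace.re ≤ σ₀.trace.re}
  have htr : Continuous fun σ : Matrix (Cfg dI) (Cfg dI) ℂ => σ.trace.re := by fun_prop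
  have hK : IsCompact K := by
    refine (isCompact_univ_pi fun _ => isCompact_univ_pi fun _ =>
      isCompact_closedBall (0 : ℂ) σ₀.trace.re).of_isClosed_subset
      ((isClosed_dominates W).inter (isClosed_le htr continuous_const)) ?_
    rintro σ ⟨hσ, hle⟩ i - j -
    rw [mem_closedBall_zero_iff]
    exact (norm_apply_le_re_trace (hσ.posSemidef hdO hW.1) i j).trans hle
  obtain ⟨σ, ⟨hσ, hle⟩, hmin⟩ := hK.exists_isMinOn ⟨σ₀, hσ₀, le_rfl⟩ htr.continuousOn
  have hleast : IsLeast (noiseLevels W) (σ.trace.re - 1) := by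
    refine ⟨(mem_noiseLevels_iff hdO hW).mpr ⟨σ, hσ, ?_⟩, fun s hs => ?_⟩
    · rw [add_sub_cancel]
      exact Complex.eq_re_of_ofReal_le (r := 0)
        (by simpa using (hσ.posSemidef hdO hW.1).trace_nonneg)
    · obtain ⟨τ, hτ, hs⟩ := (mem_noiseLevels_iff hdO hW).mp hs
      have hs' : τ.trace.re = 1 + s := by rw [hs, Complex.ofReal_re]
      rcases le_total τ.trace.re σ₀.trace.re with h | h
      · have := isMinOn_iff.mp hmin τ ⟨hτ, h⟩
        linarith
      · linarith
  rwa [robustness, hleast.csInf_eq]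

theorem IsProcess.robustness_le (hdO : ∀ i, 0 < dO i) {W : Op dI dO} (hW : IsProcess W)
    {σ : Matrix (Cfg dI) (Cfg dI) ℂ} (hσ : Dominates σ W) : robustness W ≤ σ.trace.re - 1 := by
  refine (isLeast_robustness hdO hW).2 ((mem_noiseLevels_iff hdO hW).mpr ⟨σ, hσ, ?_⟩)
  rw [add_sub_cancel]
  exact Complex.eq_re_of_ofReal_le (r := 0)
    (by simpa using (hσ.posSemidef hdO hW.1).trace_nonneg)

theorem trace_kronecker_one_mul (σ : Matrix (Cfg dI) (Cfg dI) ℂ) (S : Op dI dO) :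
    (σ ⊗ₖ (1 : Matrix (Cfg dO) (Cfg dO) ℂ) * S).trace = (σ * traceOutputs S).trace := by
  simp only [Matrix.trace, Matrix.diag_apply, Matrix.mul_apply, Fintype.sum_prod_type,
    Matrix.kroneckerMap_apply, traceOutputs, Matrix.of_apply, Matrix.one_apply, mul_ite, mul_one,
    mul_zero, ite_mul, zero_mul, Finset.sum_ite_eq, Finset.mem_univ, if_true, Finset.mul_sum]
  exact Finset.sum_congr rfl fun a _ => Finset.sum_comm

/-- Weak duality. -/
theorem IsProcess.trace_mul_le_robustness (hdO : ∀ i, 0 < dO i) {W : Op dI dO} (hW : IsProcess W)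
    {S : Op dI dO} (hS : IsDualFeasible S) : (W * S).trace - 1 ≤ (robustness W : ℂ) := by
  obtain ⟨σ, hσ, htr⟩ := (mem_noiseLevels_iff hdO hW).mp (isLeast_robustness hdO hW).1
  -- The chain is `tr (W S) ≤ tr (σ tr_O S) ≤ tr σ = 1 + s`.
  have h1 := trace_mul_nonneg hσ hS.1
  have h2 := trace_mul_nonneg (hσ.posSemidef hdO hW.1) hS.2
  rw [Matrix.sub_mul, Matrix.trace_sub, trace_kronecker_one_mul, sub_nonneg] at h1
  rw [Matrix.mul_sub, Matrix.trace_sub, Matrix.mul_one, sub_nonneg, htr] at h2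
  rw [sub_le_iff_le_add]
  refine (h1.trans h2).trans_eq ?_
  push_cast
  ring

theorem convex_setOf_dominated (r : ℝ) :
    Convex ℝ {W : Op dI dO | ∃ σ, Dominates σ W ∧ σ.trace.re ≤ r} := by
  rintro V ⟨σ, hσ, hr⟩ W ⟨τ, hτ, hr'⟩ a b ha hb hab
  refine ⟨a • σ + b • τ, ?_, ?_⟩
  · have := (posSemidef_real_smul hσ ha).add (posSemidef_real_smul hτ hb)
    rw [Dominates, Matrix.add_kronecker, Matrix.smul_kronecker, Matrix.smul_kronecker]
    convert this using 1
    module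
  · rw [Matrix.trace_add, Matrix.trace_smul, Matrix.trace_smul, Complex.add_re,
      Complex.smul_re, Complex.smul_re, smul_eq_mul, smul_eq_mul]
    calc _ ≤ a * r + b * r := by gcongr
      _ = r := by rw [← add_mul, hab, one_mul]

/-! ### The upper bound for processes with a definite last party -/

/-- Changing coordinate `p` identifies the fibres of `o ↦ o p`, so all `d p` of them have the same
sum. -/
theorem mul_sum_filter_apply_eq {d : Fin (n + 1) → ℕ} (p : Fin (n + 1)) (z : Fin (d p))
    {f : Cfg d → ℂ} (hf : ∀ o z, f (Function.update o p z) = f o) :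
    (d p : ℂ) * ∑ o with o p = z, f o = ∑ o, f o := by
  have h : ∀ z' : Fin (d p), ∑ o : Cfg d with o p = z', f o = ∑ o : Cfg d with o p = z, f o :=
    fun z' => by
    refine Finset.sum_nbij' (fun o => Function.update o p z) (fun o => Function.update o p z')
      ?_ ?_ ?_ ?_ ?_ <;> intro o ho <;> have ho := (Finset.mem_filter.mp ho).2
    · simp
    · simp
    · simp [← ho]
    · simp [← ho]
    · exact (hf o z).symm
  rw [← Finset.sum_fiberwise Finset.univ (fun o : Cfg d => o p),
    Finset.sum_congr rfl fun z' _ => h z']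
  simp

theorem mul_card_filter_apply_eq {d : Fin (n + 1) → ℕ} (p : Fin (n + 1)) (z : Fin (d p)) :
    (d p : ℂ) * (Finset.univ.filter fun o : Cfg d => o p = z).card = ∏ i, (d i : ℂ) := by
  have := mul_sum_filter_apply_eq p z (f := fun _ => 1) fun _ _ => rfl
  simpa using this

/-- Together with `apply_update_of_traceReplace_eq`, this is the entrywise form of `W = W' ⊗ 1` with
the identity on the output of `p`. -/
theorem apply_eq_zero_of_traceReplace_eq {W : Op dI dO} {p : Fin (n + 1)}
    (h : traceReplace ∅ {p} W = W) {x y : Cfg dI × Cfg dO} (hxy : x.2 p ≠ y.2 p) : W x y = 0 := by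
  rw [← h]
  simp [traceReplace, hxy]

theorem glue_update {d : Fin (n + 1) → ℕ} {A : Finset (Fin (n + 1))} {p : Fin (n + 1)}
    (hp : p ∈ A) (x : Cfg d) (z : Fin (d p)) (a : ∀ i : A, Fin (d i)) :
    glue A (Function.update x p z) a = glue A x a := by
  funext i
  by_cases hi : i ∈ A
  · simp [glue, hi]
  · simp [glue, hi, show i ≠ p from fun h => hi (h ▸ hp)]

theorem apply_update_of_traceReplace_eq {W : Op dI dO} {p : Fin (n + 1)}
    (h : traceReplace ∅ {p} W = W) {x y : Cfg dI × Cfg dO} (hxy : x.2 p = y.2 p)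
    (z : Fin (dO p)) :
    W (x.1, Function.update x.2 p z) (y.1, Function.update y.2 p z) = W x y := by
  conv_rhs => rw [← h]
  conv_lhs => rw [← h]
  simp [traceReplace, hxy, glue_update]

/-- The block-diagonal part with respect to the outputs. -/
def pinch (W : Op dI dO) : Op dI dO := Matrix.of fun x y => if x.2 = y.2 then W x y else 0

/-- With `P_o` the projection onto output configuration `o`, the difference is half the sum of `(P_o
- P_o') W (P_o - P_o')` over pairs agreeing at `p`. The cross terms add up to all of `W`, since
blocks that differ at `p` vanish. Restricting the pairs in this way saves the factor `dO p` in the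
constant. -/
theorem pinching_posSemidef (hdO : ∀ i, 0 < dO i) {W : Op dI dO} (hW : W.PosSemidef)
    {p : Fin (n + 1)} (h : traceReplace ∅ {p} W = W) :
    ((((∏ i, (dO i : ℝ)) / dO p : ℝ)) • pinch W - W).PosSemidef := by
  let D : Cfg dO → Cfg dO → Op dI dO := fun o o' =>
    Matrix.diagonal fun x => (if x.2 = o then 1 else 0) - if x.2 = o' then 1 else 0
  have hD : ∀ o o', (D o o')ᴴ = D o o' := fun o o' => by
    rw [Matrix.diagonal_conjTranspose]
    congr 1
    funext x
    simp only [Pi.star_apply, star_sub]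
    split_ifs <;> simp
  have hsum : ((((∏ i, (dO i : ℝ)) / dO p : ℝ)) • pinch W - W) =
      (2⁻¹ : ℝ) • ∑ o, ∑ o' with o' p = o p, (D o o')ᴴ * W * D o o' := by
    ext x y
    have hcard : ((Finset.univ.filter fun o : Cfg dO => o p = y.2 p).card : ℂ) =
        (∏ i, (dO i : ℂ)) / dO p := by
      rw [← mul_card_filter_apply_eq p (y.2 p), mul_div_cancel_left₀]
      exact_mod_cast (hdO p).ne'
    let F : Cfg dO → Cfg dO → ℂ := fun o o' =>
      ((if x.2 = o then 1 else 0) * (if y.2 = o then 1 else 0) +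
        (if x.2 = o' then 1 else 0) * (if y.2 = o' then 1 else 0)) -
      ((if x.2 = o then 1 else 0) * (if y.2 = o' then 1 else 0) +
        (if x.2 = o' then 1 else 0) * (if y.2 = o then 1 else 0))
    have hterm : ∀ o o' : Cfg dO, ((D o o')ᴴ * W * D o o') x y = W x y * F o o' := fun o o' => by
      rw [hD, Matrix.mul_diagonal, Matrix.diagonal_mul]
      ring
    -- The relation `o' p = o p` is symmetric, so the two diagonal sums in `F` agree, and so do the
    -- two cross sums.
    have hswap : ∀ G : Cfg dO → Cfg dO → ℂ, ∑ o : Cfg dO, ∑ o' : Cfg dO with o' p = o p, G o' o =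
        ∑ o : Cfg dO, ∑ o' : Cfg dO with o' p = o p, G o o' := fun G => by
      simp only [Finset.sum_filter]
      rw [Finset.sum_comm]
      exact Finset.sum_congr rfl fun o _ => Finset.sum_congr rfl fun o' _ =>
        if_congr eq_comm rfl rfl
    have e1 : ∑ o : Cfg dO, ∑ o' : Cfg dO with o' p = o p,
        (if x.2 = o then (1 : ℂ) else 0) * (if y.2 = o then 1 else 0) =
        if x.2 = y.2 then (∏ i, (dO i : ℂ)) / dO p else 0 := by
      simp only [Finset.sum_const, nsmul_eq_mul, mul_ite, mul_one, mul_zero, Finset.sum_ite_eq,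
        Finset.mem_univ, if_true, hcard]
    have e3 : ∑ o : Cfg dO, ∑ o' : Cfg dO with o' p = o p,
        (if x.2 = o then (1 : ℂ) else 0) * (if y.2 = o' then 1 else 0) =
        if y.2 p = x.2 p then 1 else 0 := by
      simp only [← Finset.mul_sum]
      simp only [Finset.sum_ite_eq, Finset.mem_filter, Finset.mem_univ, true_and,
        ite_mul, one_mul, zero_mul, if_true]
    have hF : ∑ o : Cfg dO, ∑ o' : Cfg dO with o' p = o p, F o o' =
        2 * ((if x.2 = y.2 then (∏ i, (dO i : ℂ)) / dO p else 0) -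
          if y.2 p = x.2 p then 1 else 0) := by
      simp only [F, Finset.sum_sub_distrib, Finset.sum_add_distrib]
      rw [hswap fun o _ => (if x.2 = o then 1 else 0) * (if y.2 = o then 1 else 0),
        hswap fun o o' => (if x.2 = o then 1 else 0) * (if y.2 = o' then 1 else 0), e1, e3]
      ring
    simp only [Matrix.smul_apply, Matrix.sum_apply, hterm, ← Finset.mul_sum, hF, Matrix.sub_apply,
      pinch, Matrix.of_apply]
    by_cases hp : x.2 p = y.2 p
    · by_cases hxy : x.2 = y.2
      · simp [hxy]
        ring
      · simp [hxy, hp]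
        ring
    · have hxy : x.2 ≠ y.2 := fun h => hp (congrFun h p)
      simp [hxy, apply_eq_zero_of_traceReplace_eq h hp]
  rw [hsum]
  exact posSemidef_real_smul (Matrix.posSemidef_sum _ fun o _ => Matrix.posSemidef_sum _ fun o' _ =>
    hW.conjTranspose_mul_mul_same _) (by norm_num)

/-- Blocks do not depend on the coordinate at `p`, so `tr_O W / d_p` is the sum of the blocks `o'`
with `o' p = o p`. In block `o` the difference is that sum without `o` itself. -/
theorem traceOutputs_dominates_pinch (hdO : ∀ i, 0 < dO i) {W : Op dI dO} (hW : W.PosSemidef)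
    {p : Fin (n + 1)} (h : traceReplace ∅ {p} W = W) :
    Dominates ((dO p : ℝ)⁻¹ • traceOutputs W) (pinch W) := by
  have hsum : ((dO p : ℝ)⁻¹ • traceOutputs W) ⊗ₖ (1 : Matrix (Cfg dO) (Cfg dO) ℂ) - pinch W =
      ∑ o, ∑ o' ∈ (Finset.univ.filter fun o' => o' p = o p).erase o,
        W.submatrix (fun a => (a, o')) (fun a => (a, o')) ⊗ₖ
          Matrix.diagonal fun x : Cfg dO => if x = o then (1 : ℂ) else 0 := by
    ext ⟨a, o₁⟩ ⟨a', o₂⟩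
    simp only [Matrix.sum_apply, Matrix.sub_apply, Matrix.kroneckerMap_apply, pinch,
      Matrix.of_apply, Matrix.submatrix_apply, Matrix.diagonal_apply, Matrix.smul_apply]
    by_cases ho : o₁ = o₂
    · subst ho
      have hf := mul_sum_filter_apply_eq p (o₁ p) (f := fun o => W (a, o) (a', o)) fun o z =>
        apply_update_of_traceReplace_eq h (x := (a, o)) (y := (a', o)) rfl z
      have hp : (dO p : ℂ) ≠ 0 := by exact_mod_cast (hdO p).ne'
      simp only [if_true, Matrix.one_apply_eq, mul_one, traceOutputs, Matrix.of_apply, ← hf,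
        mul_ite, mul_zero]
      rw [Finset.sum_eq_single (s := Finset.univ) o₁]
      rotate_left
      · intro o _ hne
        simp [hne.symm]
      · simp
      simp only [if_true]
      rw [Finset.sum_erase_eq_sub (by simp), Complex.real_smul]
      push_cast
      rw [inv_mul_cancel_left₀ hp]
    · simp [ho]
  rw [Dominates, hsum]
  refine Matrix.posSemidef_sum _ fun o _ => Matrix.posSemidef_sum _ fun o' _ =>
    (hW.submatrix _).kronecker (Matrix.PosSemidef.diagonal fun x => ?_)
  dsimp only
  split_ifs <;> simp

theorem trace_traceOutputs (W : Op dI dO) : (traceOutputs W).trace = W.trace := by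
  simp [traceOutputs, Matrix.trace, Fintype.sum_prod_type]

theorem exists_dominates_of_mem_lastPartyProcesses (hdO : ∀ i, 0 < dO i) {W : Op dI dO}
    {p : Fin (n + 1)} (hW : W ∈ lastPartyProcesses dI dO p) :
    ∃ σ, Dominates σ W ∧ σ.trace.re = ((∏ i, (dO i : ℝ)) / dO p) ^ 2 := by
  obtain ⟨hW, h⟩ := hW
  set K : ℝ := (∏ i, (dO i : ℝ)) / dO p with hK
  refine ⟨K • (dO p : ℝ)⁻¹ • traceOutputs W, ?_, ?_⟩
  · have h1 := posSemidef_real_smul (traceOutputs_dominates_pinch hdO hW.1 h)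
      (show 0 ≤ K by positivity)
    have := h1.add (pinching_posSemidef hdO hW.1 h)
    rw [smul_sub, ← Matrix.smul_kronecker, sub_add_sub_cancel] at this
    exact this
  · rw [Matrix.trace_smul, Matrix.trace_smul, trace_traceOutputs, hW.trace_eq hdO, Complex.smul_re,
      Complex.smul_re, smul_eq_mul, smul_eq_mul]
    have : (∏ i, (dO i : ℂ)).re = ∏ i, (dO i : ℝ) := by
      have : ∏ i, (dO i : ℂ) = ((∏ i, (dO i : ℝ) : ℝ) : ℂ) := by push_cast; rfl
      rw [this, Complex.ofReal_re]
    rw [this, hK]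
    ring

theorem dimBar_mul (π : Equiv.Perm (Fin (n + 1))) :
    dimBar dO π * dO (π (Fin.last n)) = ∏ i, dO i := by
  rw [dimBar, ← Equiv.prod_comp π, Fin.prod_univ_castSucc]

theorem dimBar_eq_div (hdO : ∀ i, 0 < dO i) (π : Equiv.Perm (Fin (n + 1))) :
    (dimBar dO π : ℝ) = (∏ i, (dO i : ℝ)) / dO (π (Fin.last n)) := by
  rw [eq_div_iff (by exact_mod_cast (hdO _).ne')]
  exact_mod_cast dimBar_mul π

theorem robustness_le_of_mem_lastPartyHull (hdO : ∀ i, 0 < dO i)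
    (hmax : ∀ π : Equiv.Perm (Fin (n + 1)), dimBar dO π ≤ dimBar dO 1) {W : Op dI dO}
    (hW : W ∈ lastPartyHull dI dO) : robustness W ≤ (dimBar dO 1 : ℝ) ^ 2 - 1 := by
  have hsub : lastPartyHull dI dO ⊆ {W | IsProcess W} ∩
      {W | ∃ σ, Dominates σ W ∧ σ.trace.re ≤ (dimBar dO 1 : ℝ) ^ 2} := by
    refine convexHull_min (Set.iUnion_subset fun p W hW => ⟨hW.1, ?_⟩)
      (IsProcess.convex.inter (convex_setOf_dominated _))
    obtain ⟨σ, hσ, htr⟩ := exists_dominates_of_mem_lastPartyProcesses hdO hW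
    refine ⟨σ, hσ, htr.trans_le ?_⟩
    -- The swap is an order in which `p` comes last.
    have := dimBar_eq_div hdO (Equiv.swap p (Fin.last n))
    rw [Equiv.swap_apply_right] at this
    rw [← this]
    gcongr
    exact hmax _
  obtain ⟨hP, σ, hσ, hle⟩ := hsub hW
  exact (hP.robustness_le hdO hσ).trans (sub_le_sub_right hle 1)

theorem maxBound_eq (hmax : ∀ π : Equiv.Perm (Fin (n + 1)), dimBar dO π ≤ dimBar dO 1) :
    maxBound dO = (dimBar dO 1 : ℝ) ^ 2 - 1 := by
  refine le_antisymm (Finset.sup'_le _ _ fun π _ => ?_) (Finset.le_sup'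
    (fun π : Equiv.Perm (Fin (n + 1)) => (dimBar dO π : ℝ) ^ 2 - 1) (Finset.mem_univ 1))
  gcongr
  exact hmax π

/-! ### Products of channels are processes -/

theorem sum_cfg_cons {n : ℕ} {d : Fin (n + 1) → ℕ} (f : Cfg d → ℂ) :
    ∑ x, f x = ∑ a : Fin (d 0), ∑ t : (∀ i : Fin n, Fin (d i.succ)), f (Fin.cons a t) := by
  rw [← (Fin.consEquiv fun i => Fin (d i)).sum_comp, Fintype.sum_prod_type]
  rfl

/-- The output state of the operation `M` followed by the channel `C`, on the input `ρ`; all three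
are contracted in the Choi convention of `tensorLocal`. -/
def linkState {α β γ : Type} [Fintype α] [Fintype β]
    (ρ : Matrix α α ℂ) (M : Matrix (α × β) (α × β) ℂ) (C : Matrix (β × γ) (β × γ) ℂ) :
    Matrix γ γ ℂ :=
  Matrix.of fun s s' => ∑ a, ∑ b, ∑ a', ∑ b', ρ a a' * M (a, b) (a', b') * C (b, s) (b', s')

theorem sum_mul_eq_trace {α β : Type} [Fintype α] [DecidableEq α] [Fintype β]
    (ρ : Matrix α α ℂ) {M : Matrix (α × β) (α × β) ℂ} (hM : IsChannelChoi M) :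
    ∑ a, ∑ b, ∑ a', ρ a a' * M (a, b) (a', b) = ρ.trace := by
  have h : ∀ a a', ∑ b, M (a, b) (a', b) = if a = a' then 1 else 0 := fun a a' => by
    have := congrFun (congrFun hM.2 a) a'
    simpa [Matrix.one_apply] using this
  refine Finset.sum_congr rfl fun a _ => ?_
  rw [Finset.sum_comm]
  simp [← Finset.mul_sum, h]

theorem trace_linkState {α β γ : Type} [Fintype α] [DecidableEq α] [Fintype β] [DecidableEq β]
    [Fintype γ] (ρ : Matrix α α ℂ) {M : Matrix (α × β) (α × β) ℂ} (hM : IsChannelChoi M)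
    {C : Matrix (β × γ) (β × γ) ℂ} (hC : IsChannelChoi C) :
    (linkState ρ M C).trace = ρ.trace := by
  have h : ∀ b b', ∑ s, C (b, s) (b', s) = if b = b' then 1 else 0 := fun b b' => by
    have := congrFun (congrFun hC.2 b) b'
    simpa [Matrix.one_apply] using this
  rw [← sum_mul_eq_trace ρ hM]
  simp only [Matrix.trace, Matrix.diag_apply, linkState, Matrix.of_apply]
  rw [Finset.sum_comm]
  refine Finset.sum_congr rfl fun a _ => ?_
  rw [Finset.sum_comm]
  refine Finset.sum_congr rfl fun b _ => ?_
  rw [Finset.sum_comm]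
  refine Finset.sum_congr rfl fun a' _ => ?_
  rw [Finset.sum_comm]
  simp [← Finset.mul_sum, h]

theorem sum_reorder {A B A' B' T O T' O' : Type} [Fintype A] [Fintype B] [Fintype A'] [Fintype B']
    [Fintype T] [Fintype O] [Fintype T'] [Fintype O']
    (f : A → T → B → O → A' → T' → B' → O' → ℂ) :
    ∑ a, ∑ t, ∑ b, ∑ o, ∑ a', ∑ t', ∑ b', ∑ o', f a t b o a' t' b' o' =
      ∑ t, ∑ o, ∑ t', ∑ o', ∑ a, ∑ b, ∑ a', ∑ b', f a t b o a' t' b' o' := by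
  simp only [← Fintype.sum_prod_type']
  exact Fintype.sum_equiv
    { toFun := fun (a, t, b, o, a', t', b', o') => (t, o, t', o', a, b, a', b')
      invFun := fun (t, o, t', o', a, b, a', b') => (a, t, b, o, a', t', b', o')
      left_inv := fun _ => rfl
      right_inv := fun _ => rfl } _ _ fun _ => rfl

/-- Induction on the number of parties: the first operation and the first channel are absorbed into
the initial state by `linkState`, which preserves the trace and leaves a shorter chain. -/
theorem sum_chainProduct_mul_tensorLocal : ∀ {n : ℕ} {dI dO : Fin (n + 1) → ℕ}
    (ρ : Matrix (Fin (dI 0)) (Fin (dI 0)) ℂ)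
    {C : ∀ i : Fin n, Matrix (Fin (dO i.castSucc) × Fin (dI i.succ))
      (Fin (dO i.castSucc) × Fin (dI i.succ)) ℂ} (_ : ∀ i, IsChannelChoi (C i))
    {M : ∀ i, Matrix (Fin (dI i) × Fin (dO i)) (Fin (dI i) × Fin (dO i)) ℂ}
    (_ : ∀ i, IsChannelChoi (M i)),
    ∑ x₁ : Cfg dI, ∑ x₂ : Cfg dO, ∑ y₁ : Cfg dI, ∑ y₂ : Cfg dO,
      chainProduct ρ C 1 (x₁, x₂) (y₁, y₂) * tensorLocal M (x₁, x₂) (y₁, y₂) = ρ.trace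
  | 0, dI, dO, ρ, C, _, M, hM => by
    rw [← sum_mul_eq_trace ρ (hM 0)]
    have key : ∀ (a : Fin (dI 0)) t (b : Fin (dO 0)) o (a' : Fin (dI 0)) t' (b' : Fin (dO 0)) o',
        chainProduct ρ C 1 (Fin.cons a t, Fin.cons b o) (Fin.cons a' t', Fin.cons b' o') *
          tensorLocal M (Fin.cons a t, Fin.cons b o) (Fin.cons a' t', Fin.cons b' o') =
        if b = b' then ρ a a' * M 0 (a, b) (a', b') else 0 := fun a t b o a' t' b' o' => by
      simp only [chainProduct, tensorLocal, Matrix.of_apply, Finset.univ_eq_empty,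
        Finset.prod_empty, Fin.prod_univ_succ, mul_one]
      change ρ a a' * (1 : Matrix (Fin (dO 0)) (Fin (dO 0)) ℂ) b b' * M 0 (a, b) (a', b') = _
      rw [Matrix.one_apply]
      split_ifs <;> simp
    simp only [sum_cfg_cons, key, Fintype.sum_unique]
    simp
  | n + 1, dI, dO, ρ, C, hC, M, hM => by
    have key : ∀ (a : Fin (dI 0)) t (b : Fin (dO 0)) o (a' : Fin (dI 0)) t' (b' : Fin (dO 0)) o',
        chainProduct ρ C 1 (Fin.cons a t, Fin.cons b o) (Fin.cons a' t', Fin.cons b' o') *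
          tensorLocal M (Fin.cons a t, Fin.cons b o) (Fin.cons a' t', Fin.cons b' o') =
        (ρ a a' * M 0 (a, b) (a', b') * C 0 (b, t 0) (b', t' 0)) *
        ((∏ i : Fin n, C i.succ (o i.castSucc, t i.succ) (o' i.castSucc, t' i.succ)) *
          (1 : Matrix (Fin (dO (Fin.last n).succ)) (Fin (dO (Fin.last n).succ)) ℂ)
            (o (Fin.last n)) (o' (Fin.last n)) *
          ∏ i, M i.succ (t i, o i) (t' i, o' i)) := fun a t b o a' t' b' o' => by
      simp only [chainProduct, tensorLocal, Matrix.of_apply]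
      rw [Fin.prod_univ_succ, Fin.prod_univ_succ (n := n + 1)]
      change ρ a a' * (C 0 (b, t 0) (b', t' 0) *
        ∏ i : Fin n, C i.succ (o i.castSucc, t i.succ) (o' i.castSucc, t' i.succ)) *
          (1 : Matrix (Fin (dO (Fin.last n).succ)) (Fin (dO (Fin.last n).succ)) ℂ)
            (o (Fin.last n)) (o' (Fin.last n)) *
          (M 0 (a, b) (a', b') * ∏ i : Fin (n + 1), M i.succ (t i, o i) (t' i, o' i)) = _
      ring
    have ih := sum_chainProduct_mul_tensorLocal (dI := fun i => dI i.succ)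
      (dO := fun i => dO i.succ) (linkState ρ (M 0) (C 0)) (C := fun i => C i.succ)
      (fun i => hC i.succ) (M := fun i => M i.succ) fun i => hM i.succ
    rw [trace_linkState ρ (hM 0) (hC 0)] at ih
    rw [← ih]
    simp only [sum_cfg_cons (d := dI), sum_cfg_cons (d := dO), key]
    rw [sum_reorder]
    simp only [← Finset.sum_mul]
    refine Finset.sum_congr rfl fun t _ => Finset.sum_congr rfl fun o _ =>
      Finset.sum_congr rfl fun t' _ => Finset.sum_congr rfl fun o' _ => ?_
    simp only [chainProduct, tensorLocal, linkState, Matrix.of_apply]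
    rw [← mul_assoc, ← mul_assoc]
    rfl

/-! ### Trace-and-replace maps -/

/-- Averaging over the coordinates in `A` equals averaging over all coordinates. Sums over partial
configurations thus become sums over full ones, and `glue` becomes `Finset.piecewise`. -/
theorem inv_prod_mul_sum_eq {d : Fin (n + 1) → ℕ} (hd : ∀ i, 0 < d i) (A : Finset (Fin (n + 1)))
    (f : (∀ i : A, Fin (d i)) → ℂ) :
    (∏ i ∈ A, (d i : ℂ))⁻¹ * ∑ a, f a = (∏ i, (d i : ℂ))⁻¹ * ∑ c : Cfg d, f fun i => c i := by
  have h : ∑ c : Cfg d, (f fun i => c i) = (∏ i ∈ Aᶜ, (d i : ℂ)) * ∑ a, f a := by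
    rw [← (Equiv.piEquivPiSubtypeProd (· ∈ A) fun i => Fin (d i)).symm.sum_comp,
      Fintype.sum_prod_type]
    have : ∀ (a : ∀ i : {i // i ∈ A}, Fin (d i)) (b : ∀ i : {i // i ∉ A}, Fin (d i)),
        (fun i : A => (Equiv.piEquivPiSubtypeProd (· ∈ A) fun i => Fin (d i)).symm (a, b) i) = a :=
      fun a b => by
        funext i
        simp [Equiv.piEquivPiSubtypeProd]
    simp only [this, Finset.sum_const, Finset.card_univ, Fintype.card_pi, Fintype.card_fin,
      nsmul_eq_mul, ← Finset.mul_sum]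
    rw [← Finset.prod_subtype Aᶜ (p := fun i => i ∉ A) (by simp) fun i => d i]
    push_cast
    rfl
  have h0 : ∀ s : Finset (Fin (n + 1)), ∏ i ∈ s, (d i : ℂ) ≠ 0 := fun s =>
    Finset.prod_ne_zero_iff.mpr fun i _ => by exact_mod_cast (hd i).ne'
  rw [h, ← Finset.prod_mul_prod_compl A]
  have := h0 A
  have := h0 Aᶜ
  field_simp

theorem glue_restrict {d : Fin (n + 1) → ℕ} (A : Finset (Fin (n + 1))) (x c : Cfg d) :
    glue A x (fun i => c i) = A.piecewise c x := by
  funext i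
  by_cases hi : i ∈ A <;> simp [glue, hi]

theorem traceReplace_apply (hdI : ∀ i, 0 < dI i) (hdO : ∀ i, 0 < dO i)
    (A B : Finset (Fin (n + 1))) (W : Op dI dO) (x y : Cfg dI × Cfg dO) :
    traceReplace A B W x y =
      if (∀ i ∈ A, x.1 i = y.1 i) ∧ (∀ i ∈ B, x.2 i = y.2 i) then
        (∏ i, (dI i : ℂ))⁻¹ * ((∏ i, (dO i : ℂ))⁻¹ * ∑ b : Cfg dO, ∑ a : Cfg dI,
          W (A.piecewise a x.1, B.piecewise b x.2) (A.piecewise a y.1, B.piecewise b y.2))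
      else 0 := by
  simp only [traceReplace, Matrix.of_apply]
  refine if_congr Iff.rfl ?_ rfl
  rw [mul_inv, mul_assoc, Finset.mul_sum, Finset.sum_comm]
  simp only [← glue_restrict, inv_prod_mul_sum_eq hdO]
  rw [inv_prod_mul_sum_eq hdI, ← Finset.mul_sum]

theorem traceReplace_empty (W : Op dI dO) : traceReplace ∅ ∅ W = W := by
  ext x y
  have : ∀ {d : Fin (n + 1) → ℕ} (x : Cfg d) (a : ∀ i : (∅ : Finset (Fin (n + 1))), Fin (d i)),
      glue ∅ x a = x := fun x a => by
    funext i
    simp [glue]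
  simp [traceReplace, this]

theorem mul_sum_apply_self {d : Fin (n + 1) → ℕ} (k : Fin (n + 1)) {G : Cfg d → Fin (d k) → ℂ}
    (hG : ∀ b z z', G (Function.update b k z') z = G b z) :
    (d k : ℂ) * ∑ b, G b (b k) = ∑ z, ∑ b, G b z := by
  rw [← Finset.sum_fiberwise Finset.univ (fun b : Cfg d => b k), Finset.mul_sum]
  refine Finset.sum_congr rfl fun z _ => ?_
  rw [← mul_sum_filter_apply_eq k z (f := fun b => G b z) fun b z' => hG b z z']
  congr 1
  refine Finset.sum_congr rfl fun b hb => ?_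
  rw [(Finset.mem_filter.mp hb).2]

/-- If, after the spaces in `A` and `B` have been traced out, the output of `k` carries an
identity, then it may be traced out and replaced as well. -/
theorem traceReplace_insert (hdI : ∀ i, 0 < dI i) (hdO : ∀ i, 0 < dO i)
    {A B : Finset (Fin (n + 1))} {k : Fin (n + 1)} (hk : k ∉ B) {W : Op dI dO}
    (h0 : ∀ (x₁ y₁ a : Cfg dI) (x₂ y₂ b : Cfg dO), x₂ k ≠ y₂ k →
      W (A.piecewise a x₁, B.piecewise b x₂) (A.piecewise a y₁, B.piecewise b y₂) = 0)
    (h1 : ∀ (x₁ y₁ : Cfg dI) (x₂ y₂ b : Cfg dO) (z z' : Fin (dO k)),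
      ∑ a : Cfg dI, W (A.piecewise a x₁, B.piecewise b (Function.update x₂ k z))
        (A.piecewise a y₁, B.piecewise b (Function.update y₂ k z)) =
      ∑ a : Cfg dI, W (A.piecewise a x₁, B.piecewise b (Function.update x₂ k z'))
        (A.piecewise a y₁, B.piecewise b (Function.update y₂ k z'))) :
    traceReplace A B W = traceReplace A (insert k B) W := by
  ext x y
  rw [traceReplace_apply hdI hdO, traceReplace_apply hdI hdO]
  by_cases hxy : x.2 k = y.2 k
  · refine if_congr (by simp [hxy]) ?_ rfl
    congr 2
    let G : Cfg dO → Fin (dO k) → ℂ := fun b z => ∑ a : Cfg dI,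
      W (A.piecewise a x.1, B.piecewise b (Function.update x.2 k z))
        (A.piecewise a y.1, B.piecewise b (Function.update y.2 k z))
    have hpw : ∀ (b u : Cfg dO), (insert k B).piecewise b u =
        B.piecewise b (Function.update u k (b k)) := fun b u => by
      funext i
      by_cases hB : i ∈ B
      · simp [hB]
      · by_cases hi : i = k
        · subst hi
          simp [hB]
        · simp [hB, hi]
    have hG := mul_sum_apply_self k (G := G) fun b z z' => by
      have : ∀ u : Cfg dO, B.piecewise (Function.update b k z') u = B.piecewise b u := fun u =>
        B.piecewise_congr (fun i hi => Function.update_of_ne (ne_of_mem_of_not_mem hi hk) _ _)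
          fun _ _ => rfl
      simp only [G, this]
    have hGz : ∀ b z, G b z = G b (x.2 k) := fun b z => h1 _ _ _ _ _ _ _
    have hself : ∀ b, G b (x.2 k) = ∑ a : Cfg dI,
        W (A.piecewise a x.1, B.piecewise b x.2) (A.piecewise a y.1, B.piecewise b y.2) :=
      fun b => by
        simp only [G]
        rw [Function.update_eq_self, hxy, Function.update_eq_self]
    have hd : (dO k : ℂ) ≠ 0 := by exact_mod_cast (hdO k).ne'
    have hR : (∑ b : Cfg dO, ∑ a : Cfg dI, W (A.piecewise a x.1, (insert k B).piecewise b x.2)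
        (A.piecewise a y.1, (insert k B).piecewise b y.2)) = ∑ b, G b (b k) := by
      simp only [hpw, G]
    rw [hR]
    refine mul_left_cancel₀ hd (Eq.trans ?_ hG.symm)
    simp only [hGz, hself]
    simp
  · rw [if_neg (c := (∀ i ∈ A, x.1 i = y.1 i) ∧ ∀ i ∈ insert k B, x.2 i = y.2 i)
      fun h => hxy (h.2 k (Finset.mem_insert_self k B))]
    simp [h0 _ _ _ _ _ _ hxy]

/-! ### The chain of padded identity channels -/

/-- Each output agrees with the next input. -/
def OnPath (x : Cfg dI × Cfg dO) : Prop := ∀ i : Fin n, (x.2 i.castSucc : ℕ) = x.1 i.succ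

instance (x : Cfg dI × Cfg dO) : Decidable (OnPath x) :=
  inferInstanceAs (Decidable (∀ i : Fin n, (x.2 i.castSucc : ℕ) = x.1 i.succ))

theorem chainProduct_paddedId_apply (a b : ℂ) (x y : Cfg dI × Cfg dO) :
    chainProduct (a • 1) (fun i => paddedId (dO i.castSucc) (dI i.succ)) (b • 1) x y =
      if OnPath x ∧ OnPath y ∧ x.1 0 = y.1 0 ∧ x.2 (Fin.last n) = y.2 (Fin.last n) then a * b
      else 0 := by
  simp only [chainProduct, Matrix.of_apply, paddedId, Matrix.smul_apply, Matrix.one_apply,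
    Finset.prod_ite_zero, Finset.prod_const_one, Finset.mem_univ, true_imp_iff, forall_and,
    OnPath, smul_eq_mul]
  by_cases h1 : x.1 0 = y.1 0 <;> by_cases h2 : x.2 (Fin.last n) = y.2 (Fin.last n) <;>
    by_cases h3 : ∀ i : Fin n, (x.2 i.castSucc : ℕ) = x.1 i.succ <;>
    by_cases h4 : ∀ i : Fin n, (y.2 i.castSucc : ℕ) = y.1 i.succ <;> simp [h1, h2, h3, h4]

theorem idChain_apply (x y : Cfg dI × Cfg dO) :
    idChain dI dO x y =
      if OnPath x ∧ OnPath y ∧ x.1 0 = y.1 0 ∧ x.2 (Fin.last n) = y.2 (Fin.last n) then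
        (dI 0 : ℂ)⁻¹ else 0 := by
  have := chainProduct_paddedId_apply (dI := dI) (dO := dO) (dI 0 : ℂ)⁻¹ 1 x y
  rwa [one_smul, mul_one] at this

theorem chainWitness_apply (x y : Cfg dI × Cfg dO) :
    chainWitness dI dO x y =
      if OnPath x ∧ OnPath y ∧ x.1 0 = y.1 0 ∧ x.2 (Fin.last n) = y.2 (Fin.last n) then
        (dO (Fin.last n) : ℂ)⁻¹ else 0 := by
  have := chainProduct_paddedId_apply (dI := dI) (dO := dO) 1 (dO (Fin.last n) : ℂ)⁻¹ x y
  rwa [one_smul, one_mul] at this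

variable (dI dO) in
/-- The linear map that reads off the free ends (first input, last output) of a path. -/
def pathEnds : Matrix (Fin (dI 0) × Fin (dO (Fin.last n))) (Cfg dI × Cfg dO) ℂ :=
  Matrix.of fun e x => if OnPath x ∧ (x.1 0, x.2 (Fin.last n)) = e then 1 else 0

theorem pathEnds_conjTranspose_mul_self_apply (x y : Cfg dI × Cfg dO) :
    ((pathEnds dI dO)ᴴ * pathEnds dI dO) x y =
      if OnPath x ∧ OnPath y ∧ x.1 0 = y.1 0 ∧ x.2 (Fin.last n) = y.2 (Fin.last n) then 1
      else 0 := by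
  simp only [Matrix.mul_apply, Matrix.conjTranspose_apply, pathEnds, Matrix.of_apply]
  by_cases hx : OnPath x <;> by_cases hy : OnPath y <;> simp [hx, hy, eq_comm]

theorem idChain_eq : idChain dI dO =
    (dI 0 : ℂ)⁻¹ • ((pathEnds dI dO)ᴴ * pathEnds dI dO) := by
  ext x y
  rw [idChain_apply, Matrix.smul_apply, pathEnds_conjTranspose_mul_self_apply]
  simp

theorem chainWitness_eq : chainWitness dI dO =
    (dO (Fin.last n) : ℂ)⁻¹ • ((pathEnds dI dO)ᴴ * pathEnds dI dO) := by
  ext x y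
  rw [chainWitness_apply, Matrix.smul_apply, pathEnds_conjTranspose_mul_self_apply]
  simp

/-- A path with given ends is determined by the outputs of all parties but the last; `hle` allows
these to be chosen freely. -/
theorem card_onPath (hle : ∀ i : Fin n, dO i.castSucc ≤ dI i.succ)
    (e : Fin (dI 0) × Fin (dO (Fin.last n))) :
    (Finset.univ.filter fun x : Cfg dI × Cfg dO =>
      OnPath x ∧ (x.1 0, x.2 (Fin.last n)) = e).card = dimBar dO 1 := by
  have hcard : dimBar dO 1 = Fintype.card (∀ i : Fin n, Fin (dO i.castSucc)) := by
    simp [dimBar]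
  rw [hcard, ← Finset.card_univ]
  refine Finset.card_nbij' (fun x i => x.2 i.castSucc)
    (fun o => (Fin.cons e.1 fun i => Fin.castLE (hle i) (o i), Fin.snoc o e.2)) ?_ ?_ ?_ ?_
  · simp
  · intro o _
    exact Finset.mem_coe.mpr (Finset.mem_filter.mpr
      ⟨Finset.mem_univ _, fun i => by simp, by simp⟩)
  · rintro ⟨x₁, x₂⟩ hx
    obtain ⟨hp, rfl⟩ := (Finset.mem_filter.mp hx).2
    refine Prod.ext (funext fun i => ?_) (funext fun i => ?_)
    · refine Fin.cases ?_ (fun i => ?_) i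
      · simp
      · simpa [Fin.ext_iff] using hp i
    · refine Fin.lastCases ?_ (fun i => ?_) i <;> simp
  · intro o _
    simp

/-- Rows for different ends have disjoint supports, and each has `dimBar dO 1` entries equal to one.
-/
theorem pathEnds_mul_conjTranspose_self (hle : ∀ i : Fin n, dO i.castSucc ≤ dI i.succ) :
    pathEnds dI dO * (pathEnds dI dO)ᴴ = (dimBar dO 1 : ℂ) • 1 := by
  ext e e'
  simp only [Matrix.mul_apply, Matrix.conjTranspose_apply, pathEnds, Matrix.of_apply,
    Matrix.smul_apply, Matrix.one_apply, smul_eq_mul]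
  by_cases h : e = e'
  · subst h
    simp [← card_onPath hle e, ← ite_and]
  · rw [if_neg h, mul_zero]
    refine Finset.sum_eq_zero fun x _ => ?_
    by_cases hx : (x.1 0, x.2 (Fin.last n)) = e
    · simp [hx, h]
    · simp [hx]

theorem trace_idChain_mul_chainWitness (hdI : ∀ i, 0 < dI i) (hdO : ∀ i, 0 < dO i)
    (hle : ∀ i : Fin n, dO i.castSucc ≤ dI i.succ) :
    (idChain dI dO * chainWitness dI dO).trace = (dimBar dO 1 : ℂ) ^ 2 := by
  have h1 : (dI 0 : ℂ) ≠ 0 := by exact_mod_cast (hdI 0).ne'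
  have h2 : (dO (Fin.last n) : ℂ) ≠ 0 := by exact_mod_cast (hdO _).ne'
  rw [idChain_eq, chainWitness_eq, Matrix.smul_mul, Matrix.mul_smul, Matrix.trace_smul,
    Matrix.trace_smul, Matrix.mul_assoc, Matrix.trace_mul_comm, ← Matrix.mul_assoc,
    pathEnds_mul_conjTranspose_self hle, Matrix.smul_mul, Matrix.one_mul, Matrix.smul_mul,
    pathEnds_mul_conjTranspose_self hle, Matrix.trace_smul, Matrix.trace_smul, Matrix.trace_one]
  simp only [Fintype.card_prod, Fintype.card_fin, smul_eq_mul, Nat.cast_mul]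
  field_simp

theorem idChain_posSemidef : (idChain dI dO).PosSemidef := by
  rw [idChain_eq]
  exact (Matrix.posSemidef_conjTranspose_mul_self _).smul (by positivity)

theorem chainWitness_posSemidef : (chainWitness dI dO).PosSemidef := by
  rw [chainWitness_eq]
  exact (Matrix.posSemidef_conjTranspose_mul_self _).smul (by positivity)

theorem isChannelChoi_paddedId {a b : ℕ} (h : a ≤ b) : IsChannelChoi (paddedId a b) := by
  constructor
  · convert Matrix.posSemidef_vecMulVec_self_star
      (fun x : Fin a × Fin b => if (x.1 : ℕ) = x.2 then (1 : ℂ) else 0)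
    ext x y
    simp only [paddedId, Matrix.of_apply, Matrix.vecMulVec_apply, Pi.star_apply]
    by_cases hx : (x.1 : ℕ) = x.2 <;> by_cases hy : (y.1 : ℕ) = y.2 <;> simp [hx, hy]
  · ext i j
    simp only [paddedId, Matrix.of_apply, Matrix.one_apply]
    rw [Finset.sum_eq_single (Fin.castLE h i)]
    · simp [Fin.ext_iff, eq_comm]
    · intro k _ hk
      rw [if_neg]
      rintro ⟨hik, -⟩
      exact hk (Fin.ext hik.symm)
    · simp

theorem isState_maximallyMixed {d : ℕ} (hd : 0 < d) :
    IsState ((d : ℂ)⁻¹ • (1 : Matrix (Fin d) (Fin d) ℂ)) := by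
  have : (d : ℂ) ≠ 0 := by exact_mod_cast hd.ne'
  exact ⟨Matrix.PosSemidef.one.smul (by positivity), by simp [Matrix.trace_smul, this]⟩

theorem isMarkovian_idChain (hdI : ∀ i, 0 < dI i)
    (hle : ∀ i : Fin n, dO i.castSucc ≤ dI i.succ) : IsMarkovian (idChain dI dO) :=
  ⟨_, _, isState_maximallyMixed (hdI 0), fun i => isChannelChoi_paddedId (hle i), rfl⟩

theorem isProcess_idChain (hdI : ∀ i, 0 < dI i)
    (hle : ∀ i : Fin n, dO i.castSucc ≤ dI i.succ) : IsProcess (idChain dI dO) := by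
  refine ⟨idChain_posSemidef, fun M hM => ?_⟩
  rw [trace_transpose_mul]
  simp only [Fintype.sum_prod_type, idChain]
  rw [sum_chainProduct_mul_tensorLocal _ (fun i => isChannelChoi_paddedId (hle i)) hM,
    (isState_maximallyMixed (hdI 0)).2]

theorem idChain_mem_orderedProcesses (hdI : ∀ i, 0 < dI i) (hdO : ∀ i, 0 < dO i)
    (hle : ∀ i : Fin n, dO i.castSucc ≤ dI i.succ) : idChain dI dO ∈ orderedProcesses dI dO := by
  refine ⟨isProcess_idChain hdI hle, fun k => ?_⟩
  rw [← Finset.Ioi_insert k]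
  refine traceReplace_insert hdI hdO (by simp) ?_ ?_
  · intro x₁ y₁ a x₂ y₂ b hne
    rw [idChain_apply, if_neg]
    rintro ⟨hx, hy, -, hlast⟩
    refine hne ?_
    induction k using Fin.lastCases with
    | last => simpa using hlast
    | cast j =>
      have hx := hx j
      have hy := hy j
      dsimp only at hx hy
      -- The next input is traced out, so it has the same value `a j.succ` on both sides, and both
      -- outputs of `j` must match it.
      rw [Finset.piecewise_eq_of_mem (i := j.succ) _ _ _ (by simp),
        Finset.piecewise_eq_of_notMem _ _ _ (by simp)] at hx hy
      exact Fin.ext (hx.trans hy.symm)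
  · intro x₁ y₁ x₂ y₂ b z z'
    induction k using Fin.lastCases with
    | last =>
      have hp : ∀ (a x₁ : Cfg dI) (x₂ : Cfg dO) w w',
          OnPath ((Finset.Ioi (Fin.last n)).piecewise a x₁,
            (Finset.Ioi (Fin.last n)).piecewise b (Function.update x₂ (Fin.last n) w)) ↔
          OnPath ((Finset.Ioi (Fin.last n)).piecewise a x₁,
            (Finset.Ioi (Fin.last n)).piecewise b (Function.update x₂ (Fin.last n) w')) :=
        fun a x₁ x₂ w w' => forall_congr' fun i => by
          simp only [Finset.piecewise, Function.update_of_ne (Fin.castSucc_lt_last i).ne]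
      refine Finset.sum_congr rfl fun a _ => ?_
      simp only [idChain_apply, hp a x₁ x₂ z z', hp a y₁ y₂ z z']
      simp
    | cast j =>
      -- Swapping the values `z` and `z'` of the next input permutes the traced-out configurations
      -- and carries paths with output `z` to paths with output `z'`.
      let e : Equiv.Perm (Fin (dI j.succ)) :=
        Equiv.swap (Fin.castLE (hle j) z) (Fin.castLE (hle j) z')
      let E : Equiv.Perm (Cfg dI) := Equiv.piCongrRight (Pi.mulSingle j.succ e)
      have hEj : ∀ a : Cfg dI, E a j.succ = e (a j.succ) := fun a => by simp [E]
      have hEne : ∀ (a x₁ : Cfg dI) {i}, i ≠ j.succ →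
          (Finset.Ioi j.castSucc).piecewise (E a) x₁ i =
            (Finset.Ioi j.castSucc).piecewise a x₁ i := fun a x₁ i hi => by
        have : E a i = a i := by simp [E, Pi.mulSingle_eq_of_ne hi]
        simp only [Finset.piecewise, this]
      have hu : ∀ (x₂ : Cfg dO) (w : Fin (dO j.castSucc)) {i}, i ≠ j.castSucc →
          (Finset.Ioi j.castSucc).piecewise b (Function.update x₂ j.castSucc w) i =
            (Finset.Ioi j.castSucc).piecewise b x₂ i := fun x₂ w i hi => by
        simp only [Finset.piecewise, Function.update_of_ne hi]
      have hz : ∀ c : Fin (dI j.succ), (z : ℕ) = c ↔ (z' : ℕ) = e c := fun c => by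
        have h1 : (z : ℕ) = c ↔ c = Fin.castLE (hle j) z := by rw [eq_comm, Fin.ext_iff]; rfl
        have h2 : (z' : ℕ) = e c ↔ e c = Fin.castLE (hle j) z' := by rw [eq_comm, Fin.ext_iff]; rfl
        rw [h1, h2, ← Equiv.swap_apply_left (Fin.castLE (hle j) z) (Fin.castLE (hle j) z'),
          e.apply_eq_iff_eq]
      have hp : ∀ (a x₁ : Cfg dI) (x₂ : Cfg dO),
          OnPath ((Finset.Ioi j.castSucc).piecewise (E a) x₁,
            (Finset.Ioi j.castSucc).piecewise b (Function.update x₂ j.castSucc z')) ↔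
          OnPath ((Finset.Ioi j.castSucc).piecewise a x₁,
            (Finset.Ioi j.castSucc).piecewise b (Function.update x₂ j.castSucc z)) :=
        fun a x₁ x₂ => forall_congr' fun i => by
          by_cases hi : i = j
          · subst hi
            simp [hEj, hz]
          · simp only [hEne a x₁ (fun h => hi (Fin.succ_injective _ h)),
              hu _ _ fun h => hi (Fin.castSucc_injective _ h)]
      refine Eq.trans ?_ (Equiv.sum_comp E _)
      refine Finset.sum_congr rfl fun a _ => ?_
      simp only [idChain_apply, hp, hEne _ _ (Fin.succ_ne_zero j).symm,
        hu _ _ (Fin.castSucc_lt_last j).ne']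

/-! ### The dual witness -/

/-- Off-diagonal entries vanish because equal outputs on two paths force equal later inputs, while
the first inputs agree by the identity factor. -/
theorem traceOutputs_chainWitness : traceOutputs (chainWitness dI dO) =
    Matrix.diagonal fun a : Cfg dI => (dO (Fin.last n) : ℂ)⁻¹ *
      (Finset.univ.filter fun o : Cfg dO => OnPath (a, o)).card := by
  ext a a'
  simp only [traceOutputs, Matrix.of_apply, chainWitness_apply]
  by_cases h : a = a'
  · subst h
    simp [← Finset.sum_filter, mul_comm]
  · rw [Matrix.diagonal_apply_ne _ h]
    refine Finset.sum_eq_zero fun o _ => if_neg ?_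
    rintro ⟨hp, hp', h0, -⟩
    exact h (funext fun i => Fin.cases h0 (fun i => Fin.ext ((hp i).symm.trans (hp' i))) i)

/-- Once the inputs are fixed, only the last output of a path is free. Padding can leave inputs that
no output matches, so equality needs the reverse inequalities of `le_card_onPath`. -/
theorem card_onPath_le (a : Cfg dI) :
    (Finset.univ.filter fun o : Cfg dO => OnPath (a, o)).card ≤ dO (Fin.last n) := by
  refine (Finset.card_le_card_of_injOn (t := Finset.univ) (fun o => o (Fin.last n))
    (fun _ _ => Finset.mem_coe.mpr (Finset.mem_univ _)) fun o ho o' ho' h => ?_).trans_eq (by simp)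
  have ho : OnPath (a, o) := by simpa using ho
  have ho' : OnPath (a, o') := by simpa using ho'
  exact funext fun i => Fin.lastCases h (fun i => Fin.ext ((ho i).trans (ho' i).symm)) i

theorem le_card_onPath (hge : ∀ i : Fin n, dI i.succ ≤ dO i.castSucc) (a : Cfg dI) :
    dO (Fin.last n) ≤ (Finset.univ.filter fun o : Cfg dO => OnPath (a, o)).card := by
  refine (by simp : dO (Fin.last n) = (Finset.univ : Finset (Fin (dO (Fin.last n)))).card).trans_le
    (Finset.card_le_card_of_injOn
      (fun z => (Fin.snoc (fun i : Fin n => Fin.castLE (hge i) (a i.succ)) z : Cfg dO))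
      (fun z _ => ?_) fun z _ z' _ h => ?_)
  · exact Finset.mem_coe.mpr (Finset.mem_filter.mpr ⟨Finset.mem_univ _, fun i => by simp⟩)
  · simpa using congrFun h (Fin.last n)

theorem traceOutputs_chainWitness_eq_one (hdO : ∀ i, 0 < dO i)
    (hge : ∀ i : Fin n, dI i.succ ≤ dO i.castSucc) : traceOutputs (chainWitness dI dO) = 1 := by
  have h : (dO (Fin.last n) : ℂ) ≠ 0 := by exact_mod_cast (hdO _).ne'
  rw [traceOutputs_chainWitness, ← Matrix.diagonal_one]
  congr 1
  funext a
  rw [le_antisymm (card_onPath_le a) (le_card_onPath hge a), inv_mul_cancel₀ h]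

theorem isDualFeasible_chainWitness : IsDualFeasible (chainWitness dI dO) := by
  refine ⟨chainWitness_posSemidef, ?_⟩
  rw [traceOutputs_chainWitness, ← Matrix.diagonal_one, Matrix.diagonal_sub]
  refine Matrix.PosSemidef.diagonal fun a => sub_nonneg.mpr ?_
  have h : (dO (Fin.last n) : ℝ)⁻¹ *
      ((Finset.univ.filter fun o : Cfg dO => OnPath (a, o)).card : ℝ) ≤ 1 :=
    inv_mul_le_one_of_le₀ (by exact_mod_cast card_onPath_le (dO := dO) a) (Nat.cast_nonneg _)
  have h' := Complex.real_le_real.mpr h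
  push_cast at h'
  exact h'

/-! ### Memberships -/

theorem mem_lastPartyProcesses_of_mem_orderedProcesses {W : Op dI dO}
    (hW : W ∈ orderedProcesses dI dO) : W ∈ lastPartyProcesses dI dO (Fin.last n) := by
  refine ⟨hW.1, ?_⟩
  have h := hW.2 (Fin.last n)
  have hI : Finset.Ioi (Fin.last n) = ∅ := Finset.Ioi_top
  have hJ : Finset.Ici (Fin.last n) = {Fin.last n} := Finset.Ici_top
  rw [hI, hJ, traceReplace_empty] at h
  exact h.symm

theorem mem_lastTwoProcesses_of_mem_orderedProcesses {W : Op dI dO}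
    (hW : W ∈ orderedProcesses dI dO) : W ∈ lastTwoProcesses dI dO 1 := by
  refine ⟨mem_lastPartyProcesses_of_mem_orderedProcesses hW, fun j hj => ?_⟩
  have h := hW.2 j.castSucc
  have hI : Finset.Ioi j.castSucc = {Fin.last n} := by
    ext i
    rw [Finset.mem_Ioi, Finset.mem_singleton, Fin.castSucc_lt_iff_succ_le, hj, Fin.last_le_iff]
  have hJ : Finset.Ici j.castSucc = {Fin.last n, j.castSucc} := by
    rw [← Finset.Ioi_insert, hI, Finset.pair_comm]
  rw [hI, hJ] at h
  exact h

theorem lastTwoHull_subset : lastTwoHull dI dO ⊆ lastPartyHull dI dO :=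
  convexHull_mono (Set.iUnion_subset fun π _ hW => Set.mem_iUnion.mpr ⟨π (Fin.last n), hW.1⟩)

theorem orderedProcesses_subset : orderedProcesses dI dO ⊆ lastPartyHull dI dO := fun _ hW =>
  subset_convexHull ℝ _
    (Set.mem_iUnion.mpr ⟨_, mem_lastPartyProcesses_of_mem_orderedProcesses hW⟩)

/-! ### The robustness of the chain -/

theorem robustness_idChain (hdI : ∀ i, 0 < dI i) (hdO : ∀ i, 0 < dO i)
    (hle : ∀ i : Fin n, dO i.castSucc ≤ dI i.succ)
    (hmax : ∀ π : Equiv.Perm (Fin (n + 1)), dimBar dO π ≤ dimBar dO 1) :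
    robustness (idChain dI dO) = (dimBar dO 1 : ℝ) ^ 2 - 1 := by
  refine le_antisymm (robustness_le_of_mem_lastPartyHull hdO hmax
    (orderedProcesses_subset (idChain_mem_orderedProcesses hdI hdO hle))) ?_
  have h := (isProcess_idChain hdI hle).trace_mul_le_robustness hdO isDualFeasible_chainWitness
  rw [trace_idChain_mul_chainWitness hdI hdO hle] at h
  exact_mod_cast h

theorem isOptimalWitness_chainWitness (hdI : ∀ i, 0 < dI i) (hdO : ∀ i, 0 < dO i)
    (hle : ∀ i : Fin n, dO i.castSucc ≤ dI i.succ)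
    (hmax : ∀ π : Equiv.Perm (Fin (n + 1)), dimBar dO π ≤ dimBar dO 1) :
    IsOptimalWitness (idChain dI dO) (chainWitness dI dO) := by
  refine ⟨isDualFeasible_chainWitness, ?_,
    fun S' hS' => (isProcess_idChain hdI hle).trace_mul_le_robustness hdO hS'⟩
  rw [trace_idChain_mul_chainWitness hdI hdO hle, robustness_idChain hdI hdO hle hmax]
  push_cast
  rfl

/-- The bound on the large hull settles every smaller set that still contains the chain, so a
general `P` covers the ordered processes and both hulls. -/
theorem maximizesRobustnessOn_idChain (hdI : ∀ i, 0 < dI i) (hdO : ∀ i, 0 < dO i)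
    (hle : ∀ i : Fin n, dO i.castSucc ≤ dI i.succ)
    (hmax : ∀ π : Equiv.Perm (Fin (n + 1)), dimBar dO π ≤ dimBar dO 1) {P : Set (Op dI dO)}
    (hmem : idChain dI dO ∈ P) (hP : P ⊆ lastPartyHull dI dO) :
    MaximizesRobustnessOn P (idChain dI dO) :=
  ⟨hmem, fun _ hV => (robustness_le_of_mem_lastPartyHull hdO hmax (hP hV)).trans_eq
    (robustness_idChain hdI hdO hle hmax).symm⟩

end SignallingRobustness

theorem mainTheorem4 (n : ℕ) :
    -- the minimum that defines the signalling robustness is attained, for every process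
    (∀ dI dO : Fin (n + 1) → ℕ, (∀ i, 0 < dI i) → (∀ i, 0 < dO i) →
      ∀ W : Op dI dO, IsProcess W → IsLeast (noiseLevels W) (robustness W)) ∧
    -- equal dimensions, ordered processes
    (∀ d : ℕ, 0 < d →
      let D : Fin (n + 1) → ℕ := fun _ => d
      IsMarkovian (idChain D D) ∧
      MaximizesRobustnessOn (orderedProcesses D D) (idChain D D) ∧
      robustness (idChain D D) = (d : ℝ) ^ (2 * n) - 1 ∧
      traceOutputs (chainWitness D D) = 1 ∧
      IsOptimalWitness (idChain D D) (chainWitness D D)) ∧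
    -- padded identity channels, convex hull of the processes with a definite last party
    (∀ dI dO : Fin (n + 1) → ℕ, (∀ i, 0 < dI i) → (∀ i, 0 < dO i) →
      (∀ i : Fin n, dO i.castSucc ≤ dI i.succ) →
      (∀ π : Equiv.Perm (Fin (n + 1)), dimBar dO π ≤ dimBar dO 1) →
      idChain dI dO ∈ orderedProcesses dI dO ∧
      IsMarkovian (idChain dI dO) ∧
      MaximizesRobustnessOn (lastPartyHull dI dO) (idChain dI dO) ∧
      MaximizesRobustnessOn (lastTwoHull dI dO) (idChain dI dO) ∧
      robustness (idChain dI dO) = maxBound dO ∧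
      IsOptimalWitness (idChain dI dO) (chainWitness dI dO)) := by
  refine ⟨fun dI dO _ hdO W hW => isLeast_robustness hdO hW, fun d hd => ?_,
    fun dI dO hdI hdO hle hmax => ?_⟩
  · intro D
    have hD : ∀ i, 0 < D i := fun _ => hd
    have hle : ∀ i : Fin n, D i.castSucc ≤ D i.succ := fun _ => le_rfl
    have hdim : ∀ π, dimBar D π = d ^ n := fun π => by simp [dimBar, D]
    have hmax : ∀ π, dimBar D π ≤ dimBar D 1 := fun π => by rw [hdim, hdim]
    have hord := idChain_mem_orderedProcesses hD hD hle
    refine ⟨isMarkovian_idChain hD hle,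
      maximizesRobustnessOn_idChain hD hD hle hmax hord orderedProcesses_subset, ?_,
      traceOutputs_chainWitness_eq_one hD fun _ => le_rfl,
      isOptimalWitness_chainWitness hD hD hle hmax⟩
    rw [robustness_idChain hD hD hle hmax, hdim, mul_comm 2 n, pow_mul]
    push_cast
    rfl
  · have hord := idChain_mem_orderedProcesses hdI hdO hle
    refine ⟨hord, isMarkovian_idChain hdI hle,
      maximizesRobustnessOn_idChain hdI hdO hle hmax (orderedProcesses_subset hord) subset_rfl,
      maximizesRobustnessOn_idChain hdI hdO hle hmax (subset_convexHull ℝ _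
        (Set.mem_iUnion.mpr ⟨1, mem_lastTwoProcesses_of_mem_orderedProcesses hord⟩))
        lastTwoHull_subset, ?_,
      isOptimalWitness_chainWitness hdI hdO hle hmax⟩
    rw [robustness_idChain hdI hdO hle hmax, maxBound_eq hmax]
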